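/- Let $k$ be a field of characteristic zero, let $m\ge 1$ be an integer and let $p\in k[t]$ be a nonzero polynomial. Let $\mathfrak h_m$ be the Heisenberg Lie algebra over $k$, that is, the Lie algebra with basis $X_1,\dots,X_m,Y_1,\dots,Y_m,Z$ in which $[X_i,Y_i]=-[Y_i,X_i]=Z$ for $1\le i\le m$ and all other brackets of basis vectors are zero. Let $\mathfrak h_{m,p}=\mathfrak h_m\otimes_k k[t]/(p)$, regarded as a Lie algebra over $k$ with bracket $[X\otimes q,X'\otimes q']=[X,X']\otimes qq'$ for $X,X'\in\mathfrak h_m$ and $q,q'\in k[t]/(p)$. For a Lie algebra $\mathfrak g$ over $k$ let $\mu(\mathfrak g)$ be the minimum of $\dim_k V$ over all finite-dimensional $k$-vector spaces $V$ for which there is an injective homomorphism of Lie algebras $\mathfrak g\to\mathfrak{gl}(V)$. Then \[ \mu(\mathfrak h_{m,p}) = m\,\deg p+\left\lceil 2\sqrt{\deg p}\,\right\rceil . \] -/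

import Mathlib

open Polynomial
open scoped TensorProduct

universe u v

/-- The Heisenberg Lie algebra of dimension `2 * m + 1` over `k`: the element with coordinates
`x, y, z` stands for `∑ i, x i • X i + ∑ i, y i • Y i + z • Z`, where
`X 1, …, X m, Y 1, …, Y m, Z` is the standard basis. -/
@[ext] structure HeisenbergAlgebra (k : Type u) (m : ℕ) : Type u where
  /-- the coordinates along the `X i` -/
  x : Fin m → k
  /-- the coordinates along the `Y i` -/
  y : Fin m → k
  /-- the coordinate along `Z` -/
  z : k

namespace HeisenbergAlgebra

variable {k : Type u} {m : ℕ}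

/-- The coordinates as a triple; the vector space structure is the coordinatewise one. -/
def equivProd : HeisenbergAlgebra k m ≃ (Fin m → k) × (Fin m → k) × k where
  toFun a := (a.x, a.y, a.z)
  invFun c := ⟨c.1, c.2.1, c.2.2⟩
  left_inv _ := rfl
  right_inv _ := rfl

variable [Field k]

instance : AddCommGroup (HeisenbergAlgebra k m) := equivProd.addCommGroup

instance : Module k (HeisenbergAlgebra k m) := equivProd.module k

@[simp] theorem x_add (a b : HeisenbergAlgebra k m) : (a + b).x = a.x + b.x := rfl

@[simp] theorem y_add (a b : HeisenbergAlgebra k m) : (a + b).y = a.y + b.y := rfl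

@[simp] theorem z_add (a b : HeisenbergAlgebra k m) : (a + b).z = a.z + b.z := rfl

@[simp] theorem x_zero : (0 : HeisenbergAlgebra k m).x = 0 := rfl

@[simp] theorem y_zero : (0 : HeisenbergAlgebra k m).y = 0 := rfl

@[simp] theorem z_zero : (0 : HeisenbergAlgebra k m).z = 0 := rfl

@[simp] theorem x_smul (c : k) (a : HeisenbergAlgebra k m) : (c • a).x = c • a.x := rfl

@[simp] theorem y_smul (c : k) (a : HeisenbergAlgebra k m) : (c • a).y = c • a.y := rfl

@[simp] theorem z_smul (c : k) (a : HeisenbergAlgebra k m) : (c • a).z = c * a.z := rfl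

/-- The alternating bilinear bracket whose only non-zero values on basis vectors are
`[X i, Y i] = Z` and `[Y i, X i] = -Z`. -/
instance : Bracket (HeisenbergAlgebra k m) (HeisenbergAlgebra k m) where
  bracket a b := ⟨0, 0, ∑ i, (a.x i * b.y i - b.x i * a.y i)⟩

@[simp] theorem x_lie (a b : HeisenbergAlgebra k m) : ⁅a, b⁆.x = 0 := rfl

@[simp] theorem y_lie (a b : HeisenbergAlgebra k m) : ⁅a, b⁆.y = 0 := rfl

@[simp] theorem z_lie (a b : HeisenbergAlgebra k m) :
    ⁅a, b⁆.z = ∑ i, (a.x i * b.y i - b.x i * a.y i) := rfl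

instance : LieRing (HeisenbergAlgebra k m) where
  add_lie a b c := by
    ext
    · simp
    · simp
    · simp only [z_lie, z_add, x_add, y_add, Pi.add_apply, ← Finset.sum_add_distrib]
      exact Finset.sum_congr rfl fun i _ => by ring
  lie_add a b c := by
    ext
    · simp
    · simp
    · simp only [z_lie, z_add, x_add, y_add, Pi.add_apply, ← Finset.sum_add_distrib]
      exact Finset.sum_congr rfl fun i _ => by ring
  lie_self a := by ext <;> simp
  leibniz_lie a b c := by ext <;> simp

instance : LieAlgebra k (HeisenbergAlgebra k m) where
  lie_smul c a b := by
    ext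
    · simp
    · simp
    · simp only [z_lie, z_smul, x_smul, y_smul, Pi.smul_apply, smul_eq_mul, Finset.mul_sum]
      exact Finset.sum_congr rfl fun i _ => by ring

end HeisenbergAlgebra

/-- The current Heisenberg Lie algebra: the tensor product over `k` of `k[t]/(p)` and the
Heisenberg Lie algebra, with bracket `[q₁ ⊗ X₁, q₂ ⊗ X₂] = (q₁ * q₂) ⊗ [X₁, X₂]`, viewed as a Lie
algebra over `k`. (The factor `k[t]/(p)` is written on the left, as in Mathlib.) -/
abbrev CurrentHeisenberg (k : Type u) [Field k] (m : ℕ) (p : k[X]) : Type u :=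
  AdjoinRoot p ⊗[k] HeisenbergAlgebra k m

/-- The set of dimensions of the finite-dimensional faithful representations of the Lie algebra
`L` over `k`; its least element is `μ(L)`. A representation on `V` is a Lie module structure on `V`,
equivalently a Lie algebra homomorphism `LieModule.toEnd k L V` from `L` to `End V`, and it is
faithful when this homomorphism is injective. (Letting `V` range over the universe of `k` loses
nothing: a finite-dimensional space over `k` is isomorphic to some `Fin n → k`.) -/
def faithfulRepDims (k : Type u) [Field k] (L : Type v) [LieRing L] [LieAlgebra k L] : Set ℕ :=
  {n | ∃ (V : Type u) (_ : AddCommGroup V) (_ : Module k V) (_ : FiniteDimensional k V)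
    (_ : LieRingModule L V) (_ : LieModule k L V),
    LieModule.IsFaithful k L V ∧ Module.finrank k V = n}

/-! Write A = k[t]/(p), d = deg p, W = A^m × A^m. The algebra is the two-step nilpotent algebra W ⊕
A whose bracket is the standard alternating form on W with values in A.

Lower bound. Subtracting semisimple parts makes the action on V nilpotent without changing the
centre's action, which stays injective (`exists_isNilpotent`). Choose v with the orbit A·v of
maximal dimension r and not killed by any p/f, f an irreducible factor of p (`exists_generic`).
Every nonzero ideal of A contains some p/f, so a functional φ that is nonzero on all (p/f)·v makes
φ(ω(w,w')·v) nondegenerate on W. The w with w·v in A·v form an isotropic subspace, of dimension at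
most md; hence the image of v under the whole algebra has dimension at least md + r. By nilpotency v
lies outside this image (unless v = 0), so the image has a complement T containing v, of dimension b
say. A central element killing T kills v, hence its image, hence V; so A embeds in the product of b
orbit spaces of dimension at most r, and d ≤ rb. Thus dim V ≥ md + r + b ≥ md + 2√d.

Upper bound. If d ≤ ab, block matrices on k^a × A^m × k^b give a faithful representation (`model`);
nearly equal a and b attain the ceiling. -/

/-! ### Commutator identities and nilpotency -/

section Operators

variable {k : Type*} [Field k]

/-- Bracketing with f is a derivation, and it sends g to an element commuting with g, so the chain
rule applies. -/
theorem commutator_aeval {R : Type*} [Ring R] [Algebra k R] {f g c : R}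
    (h : f * g - g * f = c) (hc : Commute c g) (P : k[X]) :
    f * aeval g P - aeval g P * f = aeval g (derivative P) * c := by
  induction P using Polynomial.induction_on' with
  | add P Q hP hQ =>
    simp only [map_add, mul_add, add_mul, ← hP, ← hQ]
    abel
  | monomial n a =>
    have key : ∀ n : ℕ, f * g ^ n - g ^ n * f = (n : R) * g ^ (n - 1) * c := by
      intro n
      induction n with
      | zero => simp
      | succ n ih =>
        have h1 : f * g ^ (n + 1) - g ^ (n + 1) * f
            = (f * g ^ n - g ^ n * f) * g + g ^ n * (f * g - g * f) := by
          rw [pow_succ]; noncomm_ring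
        rw [h1, ih, h, mul_assoc, mul_assoc, hc.eq]
        rcases n with _ | n
        · simp
        · simp only [Nat.add_sub_cancel, Nat.cast_add, Nat.cast_one, pow_succ]
          noncomm_ring
    rw [derivative_monomial, aeval_monomial, aeval_monomial, ← mul_assoc,
      ← Algebra.commutes a f, mul_assoc, mul_assoc, ← mul_sub, key]
    simp [mul_assoc]

variable {V : Type*} [AddCommGroup V] [Module k V]

/-- On the kernel of c the operators f and g commute, so there the sum is nilpotent; the kernels of
the powers of c then filter V. -/
theorem isNilpotent_add_of_commutator {f g c : Module.End k V}
    (h : f * g - g * f = c) (hcf : Commute c f) (hcg : Commute c g)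
    (hf : IsNilpotent f) (hg : IsNilpotent g) (hc : IsNilpotent c) : IsNilpotent (f + g) := by
  have hfm : ∀ x ∈ LinearMap.ker c, f x ∈ LinearMap.ker c := fun x hx => by
    have := congrArg (· x) hcf.eq
    simp_all
  have hgm : ∀ x ∈ LinearMap.ker c, g x ∈ LinearMap.ker c := fun x hx => by
    have := congrArg (· x) hcg.eq
    simp_all
  have hcomm : Commute (f.restrict hfm) (g.restrict hgm) := by
    ext ⟨x, hx⟩
    have := congrArg (· x) h
    simp only [LinearMap.mem_ker] at hx
    simp [hx, sub_eq_zero] at this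
    simpa using this
  have hfr : IsNilpotent (f.restrict hfm) := Module.End.isNilpotent.restrict hfm hf
  have hgr : IsNilpotent (g.restrict hgm) := Module.End.isNilpotent.restrict hgm hg
  obtain ⟨M, hM⟩ := hcomm.isNilpotent_add hfr hgr
  have hker : ∀ x, c x = 0 → ((f + g) ^ M) x = 0 := by
    intro x hx
    have h1 : f.restrict hfm + g.restrict hgm
        = (f + g).restrict (p := LinearMap.ker c) (q := LinearMap.ker c)
          (fun y hy => add_mem (hfm y hy) (hgm y hy)) := by
      ext; simp
    rw [h1, Module.End.pow_restrict] at hM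
    have := congrArg (fun T => ((T ⟨x, hx⟩ : LinearMap.ker c) : V)) hM
    simpa using this
  obtain ⟨N, hN⟩ := hc
  have hcs : Commute c (f + g) := hcf.add_right hcg
  -- Each application of (f + g)^M lowers the filtration by kernels of c^i by one step.
  have key : ∀ i x, (c ^ i) x = 0 → ((f + g) ^ (M * i)) x = 0 := by
    intro i
    induction i with
    | zero => intro x hx; simpa using hx
    | succ i ih =>
      intro x hx
      rw [mul_add, mul_one, pow_add, Module.End.mul_apply]
      apply ih
      rw [← Module.End.mul_apply, (hcs.pow_pow i M).eq, Module.End.mul_apply]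
      apply hker
      rwa [← Module.End.mul_apply, ← pow_succ']
  exact ⟨M * N, LinearMap.ext fun x => key N x (by simp [hN])⟩

variable [CharZero k] [FiniteDimensional k V]

/-- Bracketing the relation μ(g) = 0 repeatedly with f differentiates μ and produces a factor c each
time. -/
theorem isNilpotent_of_commutator_eq {f g c : Module.End k V}
    (h : f * g - g * f = c) (hf : Commute c f) (hg : Commute c g) : IsNilpotent c := by
  have hμ := minpoly.ne_zero_of_finite k g
  set μ := minpoly k g with hμ_def
  have key : ∀ j : ℕ, aeval g (derivative^[j] μ) * c ^ j = 0 := by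
    intro j
    induction j with
    | zero => simp [hμ_def, minpoly.aeval]
    | succ j ih =>
      have h1 := commutator_aeval (k := k) h hg (derivative^[j] μ)
      have h2 : (aeval g (derivative^[j + 1] μ) * c) * c ^ j = 0 := by
        rw [Function.iterate_succ_apply', ← h1, sub_mul, mul_assoc, mul_assoc, ih, mul_zero,
          ← (hf.pow_left j).eq, ← mul_assoc, ih, zero_mul, sub_zero]
      rw [pow_succ', ← mul_assoc, h2]
  refine ⟨μ.natDegree, ?_⟩
  -- After deg μ differentiations a constant remains: a factorial times the leading coefficient,
  -- nonzero in characteristic zero.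
  have h1 := key μ.natDegree
  have h2 : (derivative^[μ.natDegree] μ).natDegree = 0 := by
    have := natDegree_iterate_derivative μ μ.natDegree
    omega
  rw [eq_C_of_natDegree_eq_zero h2, aeval_C, coeff_iterate_derivative, zero_add,
    Nat.descFactorial_self, ← Algebra.smul_def] at h1
  refine (smul_eq_zero.1 h1).resolve_left ?_
  simp [hμ, Nat.factorial_ne_zero]

/-- Bracketing μ(s) = 0 with g gives μ'(s)[g, s] = 0, and μ'(s) is invertible because the minimal
polynomial μ is separable. -/
theorem Module.End.IsSemisimple.commute_of_commute_commutator {s g : Module.End k V}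
    (hs : s.IsSemisimple) (h : Commute (g * s - s * g) s) : Commute g s := by
  have h1 := commutator_aeval (k := k) rfl h (minpoly k s)
  rw [minpoly.aeval, mul_zero, zero_mul, sub_zero] at h1
  have hsep : (minpoly k s).Separable :=
    PerfectField.separable_iff_squarefree.2 hs.minpoly_squarefree
  obtain ⟨a, b, hab⟩ := hsep
  have h2 := congrArg (aeval s) hab
  rw [map_add, map_mul, map_mul, minpoly.aeval, mul_zero, zero_add, map_one] at h2
  have h3 : g * s - s * g = 0 := by
    rw [← one_mul (g * s - s * g), ← h2, mul_assoc, ← h1, mul_zero]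
  exact sub_eq_zero.1 h3

end Operators

/-! ### Two-step nilpotent representations and reduction to nilpotent action -/

/-- A representation on `V` of the two-step nilpotent Lie algebra with underlying space `W × A`,
with central `A` and bracket `⁅w, w'⁆ = ω w w'` on `W`. -/
structure TwoStepRep {k W A : Type*} [Field k] [AddCommGroup W] [Module k W] [AddCommGroup A]
    [Module k A] (ω : W →ₗ[k] W →ₗ[k] A) (V : Type*) [AddCommGroup V] [Module k V] where
  /-- the action of `W` -/
  act : W →ₗ[k] Module.End k V
  /-- the action of the centre -/
  center : A →ₗ[k] Module.End k V
  commute_center : ∀ a a', Commute (center a) (center a')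
  commute_act : ∀ a w, Commute (center a) (act w)
  commutator_act : ∀ w w', act w * act w' - act w' * act w = center (ω w w')

namespace TwoStepRep

variable {k W A : Type*} [Field k] [AddCommGroup W] [Module k W] [AddCommGroup A]
  [Module k A] {ω : W →ₗ[k] W →ₗ[k] A} {V : Type*} [AddCommGroup V] [Module k V]

theorem isNilpotent_act_of_basis (ρ : TwoStepRep ω V) {ι : Type*} [Fintype ι]
    (e : Module.Basis ι k W) (he : ∀ i, IsNilpotent (ρ.act (e i)))
    (hz : ∀ a, IsNilpotent (ρ.center a)) (w : W) : IsNilpotent (ρ.act w) := by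
  classical
  rw [← e.sum_repr w]
  induction (Finset.univ : Finset ι) using Finset.induction_on with
  | empty => simp
  | insert i s his ih =>
    rw [Finset.sum_insert his, map_add]
    refine isNilpotent_add_of_commutator (ρ.commutator_act _ _) (ρ.commute_act _ _)
      (ρ.commute_act _ _) ?_ ih (hz _)
    rw [map_smul]
    exact (he i).smul _

variable [CharZero k] [FiniteDimensional k W] [FiniteDimensional k V]

/-- Subtracting the semisimple parts of a basis makes a representation nilpotent. -/
theorem exists_isNilpotent (ρ : TwoStepRep ω V) (hω : ∀ a, ∃ w w', ω w w' = a) :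
    ∃ σ : TwoStepRep ω V, σ.center = ρ.center ∧ (∀ w, IsNilpotent (σ.act w)) ∧
      ∀ a, IsNilpotent (σ.center a) := by
  have hz : ∀ a, IsNilpotent (ρ.center a) := by
    intro a
    obtain ⟨w, w', rfl⟩ := hω a
    exact isNilpotent_of_commutator_eq (ρ.commutator_act w w') (ρ.commute_act _ _)
      (ρ.commute_act _ _)
  let e := Module.finBasis k W
  choose n hn s hs hnil hss hsum using fun i =>
    Module.End.exists_isNilpotent_isSemisimple (f := ρ.act (e i))
  have comm_adj : ∀ i (g T : Module.End k V), Commute g (ρ.act (e i)) →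
      T ∈ Algebra.adjoin k {ρ.act (e i)} → Commute g T := fun i g T hg hT =>
    Algebra.commute_of_mem_adjoin_singleton_of_commute hT hg
  -- Since s i = P(ρ(e i)), its bracket with ρ(w) is P'(ρ(e i)) times a central operator. This
  -- commutes with s i, so semisimplicity forces the bracket to vanish.
  have hs_act : ∀ i w, Commute (s i) (ρ.act w) := by
    intro i w
    refine (Module.End.IsSemisimple.commute_of_commute_commutator (hss i) ?_).symm
    obtain ⟨P, hP⟩ : ∃ P : k[X], aeval (ρ.act (e i)) P = s i := by
      simpa [Algebra.adjoin_singleton_eq_range_aeval] using hs i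
    have hself : Commute (s i) (ρ.act (e i)) :=
      (comm_adj i _ _ (Commute.refl _) (hs i)).symm
    have hc : Commute (ρ.center (ω w (e i))) (s i) := comm_adj i _ _ (ρ.commute_act _ _) (hs i)
    have h1 := commutator_aeval (ρ.commutator_act w (e i)) (ρ.commute_act _ _) P
    rw [hP] at h1
    rw [h1]
    refine Commute.mul_left ?_ hc
    exact (comm_adj i _ (aeval _ _) hself (aeval_mem_adjoin_singleton k _)).symm
  have hs_center : ∀ i a, Commute (ρ.center a) (s i) := fun i a =>
    comm_adj i _ _ (ρ.commute_act a _) (hs i)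
  have hs_s : ∀ i j, Commute (s i) (s j) := fun i j => comm_adj j _ _ (hs_act i _) (hs j)
  -- The semisimple part is not linear in w, so it is taken on a basis and extended linearly;
  -- nilpotency then has to be recovered from the basis.
  let S : W →ₗ[k] Module.End k V := e.constr k s
  have hS : ∀ (T : Module.End k V), (∀ i, Commute T (s i)) → ∀ w, Commute T (S w) := by
    intro T hT w
    rw [show S w = _ from e.constr_apply_fintype k s w]
    exact Commute.sum_right Finset.univ (fun i => e.equivFun w i • s i) T
      fun i _ => (hT i).smul_right _
  have hS_act : ∀ w w', Commute (ρ.act w) (S w') := fun w =>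
    hS _ fun i => (hs_act i w).symm
  have hS_S : ∀ w w', Commute (S w) (S w') := fun w => hS _ fun i => (hS _ (hs_s i) w).symm
  have hS_center : ∀ a w, Commute (ρ.center a) (S w) := fun a => hS _ fun i => hs_center i a
  let σ : TwoStepRep ω V :=
    { act := ρ.act - S
      center := ρ.center
      commute_center := ρ.commute_center
      commute_act := fun a w => (ρ.commute_act a w).sub_right (hS_center a w)
      commutator_act := fun w w' => by
        rw [← ρ.commutator_act]
        have h1 := (hS_act w w').eq
        have h2 := (hS_act w' w).eq
        have h3 := (hS_S w w').eq
        simp only [LinearMap.sub_apply, sub_mul, mul_sub, h1, h2, h3]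
        abel }
  refine ⟨σ, rfl, σ.isNilpotent_act_of_basis e (fun i => ?_) hz, hz⟩
  have : σ.act (e i) = n i := by
    simp [σ, S, hsum i]
  rw [this]
  exact hnil i

end TwoStepRep

/-! ### Generic vectors and the dimension count -/

open Module in
/-- Along a line of linear maps the rank drops below its value at the origin at most finitely
often. -/
theorem LinearMap.finite_setOf_finrank_range_add_smul_lt {k A V : Type*} [Field k]
    [AddCommGroup A] [Module k A] [AddCommGroup V] [Module k V] [FiniteDimensional k V]
    (T T' : A →ₗ[k] V) :
    {c : k | finrank k (range (T + c • T')) < finrank k (range T)}.Finite := by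
  obtain ⟨G, hG⟩ := T.rangeRestrict.exists_rightInverse_of_surjective T.range_rangeRestrict
  obtain ⟨L, hL⟩ := (range T).subtype.exists_leftInverse_of_injective (range T).ker_subtype
  have hTG : ∀ u, T (G u) = u := fun u => congrArg Subtype.val (LinearMap.congr_fun hG u)
  have hL' : ∀ u : range T, L u = u := fun u => LinearMap.congr_fun hL u
  -- Compressed to the range of T, the map T + cT' becomes 1 + cN, which is injective unless -1/c is
  -- an eigenvalue of N.
  let N : End k (range T) := L ∘ₗ T' ∘ₗ G
  refine ((End.finite_hasEigenvalue N).preimage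
    (f := fun c => -c⁻¹) (fun a _ b _ h => by simpa using h)).subset fun c hc => ?_
  by_contra hev
  refine absurd (Set.mem_ofPred_eq ▸ hc) (not_lt.2 ?_)
  have hinj : Function.Injective ((T + c • T') ∘ₗ G) := by
    rw [← LinearMap.ker_eq_bot, LinearMap.ker_eq_bot']
    intro u hu
    have h1 : u + c • N u = 0 := by
      have := congrArg L hu
      simpa [hTG, hL', N] using this
    by_contra hu0
    have hc0 : c ≠ 0 := by
      rintro rfl
      simp [hu0] at h1
    refine hev (End.hasEigenvalue_of_hasEigenvector (x := u) (End.hasEigenvector_iff.2 ⟨?_, hu0⟩))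
    rw [End.mem_eigenspace_iff, neg_smul, eq_neg_iff_add_eq_zero,
      ← smul_right_injective _ hc0 |>.eq_iff]
    simpa [hc0, add_comm] using h1
  rw [← LinearMap.finrank_range_of_inj hinj]
  exact Submodule.finrank_mono (LinearMap.range_comp_le_range _ _)

namespace TwoStepRep

open Module

variable {k W A : Type*} [Field k] [AddCommGroup W] [Module k W] [AddCommGroup A]
  [Module k A] {ω : W →ₗ[k] W →ₗ[k] A} {V : Type*} [AddCommGroup V] [Module k V]

/-- The orbit map of a vector under the centre. -/
def orbit (ρ : TwoStepRep ω V) : V →ₗ[k] A →ₗ[k] V := ρ.center.flip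

@[simp] theorem orbit_apply (ρ : TwoStepRep ω V) (v : V) (a : A) :
    ρ.orbit v a = ρ.center a v := rfl

/-- The subspace of images of `v` under the whole Lie algebra. -/
def image (ρ : TwoStepRep ω V) (v : V) : Submodule k V :=
  LinearMap.range (ρ.act.flip v) ⊔ LinearMap.range (ρ.orbit v)

/-- If v = (w + a)·v, then v is fixed by a nilpotent operator and so is zero. -/
theorem disjoint_span_image (ρ : TwoStepRep ω V) (hact : ∀ w, IsNilpotent (ρ.act w))
    (hcenter : ∀ a, IsNilpotent (ρ.center a)) (v : V) :
    Disjoint (Submodule.span k {v}) (ρ.image v) := by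
  refine (Submodule.disjoint_span_singleton.2 fun hv => ?_).symm
  obtain ⟨_, ⟨w, rfl⟩, _, ⟨a, rfl⟩, h⟩ := Submodule.mem_sup.1 hv
  obtain ⟨n, hn⟩ := (ρ.commute_act a w).symm.isNilpotent_add (hact w) (hcenter a)
  have h1 : (ρ.act w + ρ.center a) v = v := h
  have h2 : ((ρ.act w + ρ.center a) ^ n) v = v := by
    rw [Module.End.pow_apply]
    exact Function.IsFixedPt.iterate h1 n
  rw [← h2, hn, LinearMap.zero_apply]

/-- The elements of `W` moving `v` into its orbit under the centre. -/
def stabilizer (ρ : TwoStepRep ω V) (v : V) : Submodule k W :=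
  (LinearMap.range (ρ.orbit v)).comap (ρ.act.flip v)

/-- If w·v = a·v and w'·v = a'·v with a, a' central, then ww'·v = a'a·v, which is symmetric in w and
w'. -/
theorem center_stabilizer (ρ : TwoStepRep ω V) {v : V} {w w' : W} (hw : w ∈ ρ.stabilizer v)
    (hw' : w' ∈ ρ.stabilizer v) : ρ.center (ω w w') v = 0 := by
  obtain ⟨a, ha⟩ := hw
  obtain ⟨a', ha'⟩ := hw'
  simp only [orbit_apply, LinearMap.flip_apply] at ha ha'
  have c1 := fun x => LinearMap.congr_fun (ρ.commute_act a' w).eq x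
  have c2 := fun x => LinearMap.congr_fun (ρ.commute_act a w').eq x
  have c3 := fun x => LinearMap.congr_fun (ρ.commute_center a a').eq x
  simp only [Module.End.mul_apply] at c1 c2 c3
  rw [← ρ.commutator_act, LinearMap.sub_apply, Module.End.mul_apply, Module.End.mul_apply, ← ha,
    ← ha', ← c1, ← c2, ← ha, ← ha', c3, sub_self]

/-- The stabilizer is isotropic for the form φ(ω(w,w')·v), which the hypothesis makes nondegenerate.
-/
theorem two_mul_finrank_stabilizer_le [FiniteDimensional k W] (ρ : TwoStepRep ω V) (v : V)
    (φ : Dual k V) (h : ∀ w, (∀ w', φ (ρ.center (ω w w') v) = 0) → w = 0) :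
    2 * finrank k (ρ.stabilizer v) ≤ finrank k W := by
  let B : LinearMap.BilinForm k W := ω.compr₂ (φ ∘ₗ ρ.orbit v)
  have hle : ρ.stabilizer v ≤ B.orthogonal (ρ.stabilizer v) := fun w hw w' hw' => by
    simp [B, ρ.center_stabilizer hw' hw]
  have hker : LinearMap.ker B = ⊥ := LinearMap.ker_eq_bot'.2 fun w hw =>
    h w fun w' => LinearMap.congr_fun hw w'
  have h1 := LinearMap.BilinForm.finrank_add_finrank_orthogonal' (B := B) (ρ.stabilizer v)
  rw [hker, inf_bot_eq, finrank_bot] at h1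
  have h2 := Submodule.finrank_mono hle
  omega

variable [FiniteDimensional k V]

/-- There is a vector on which the centre has maximal rank and on which finitely many prescribed
nonzero central elements do not vanish. -/
theorem exists_generic [Infinite k] (ρ : TwoStepRep ω V)
    (hinj : Function.Injective ρ.center) {S : Set A} (hS : S.Finite) (hS0 : ∀ s ∈ S, s ≠ 0) :
    ∃ v, (∀ s ∈ S, ρ.center s v ≠ 0) ∧
      ∀ w, finrank k (LinearMap.range (ρ.orbit w)) ≤ finrank k (LinearMap.range (ρ.orbit v)) := by
  have := hS.to_subtype
  obtain ⟨w, hw⟩ := Submodule.exists_forall_notMem_of_forall_ne_top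
    (fun s : S => LinearMap.ker (ρ.center s)) fun s h => by
      rw [LinearMap.ker_eq_top] at h
      exact hS0 s s.2 (hinj (by rw [h, map_zero]))
  obtain ⟨v₀, hv₀⟩ : ∃ v₀, ∀ v, finrank k (LinearMap.range (ρ.orbit v))
      ≤ finrank k (LinearMap.range (ρ.orbit v₀)) := by
    have hb : BddAbove (Set.range fun v => finrank k (LinearMap.range (ρ.orbit v))) :=
      ⟨finrank k V, by rintro _ ⟨v, rfl⟩; exact Submodule.finrank_le _⟩
    obtain ⟨v₀, h⟩ := Nat.sSup_mem (Set.range_nonempty _) hb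
    exact ⟨v₀, fun v => (le_csSup hb ⟨v, rfl⟩).trans h.ge⟩
  -- On the line v₀ + c·w, each s kills at most one point, and the rank drops at finitely many; an
  -- infinite field leaves a good c.
  have hbad : (⋃ s ∈ S, {c : k | ρ.center s (v₀ + c • w) = 0}).Finite := by
    refine hS.biUnion fun s hs => Set.Subsingleton.finite fun c hc c' hc' => ?_
    have h0 : ρ.center s w ≠ 0 := hw ⟨s, hs⟩
    simp only [Set.mem_ofPred_eq, map_add, map_smul] at hc hc'
    rw [← hc', add_right_inj] at hc
    exact smul_left_injective k h0 hc
  obtain ⟨c, hc⟩ := (hbad.union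
    (LinearMap.finite_setOf_finrank_range_add_smul_lt (ρ.orbit v₀) (ρ.orbit w))).exists_notMem
  simp only [Set.mem_union, Set.mem_iUnion, Set.mem_ofPred_eq, not_or, not_exists, not_lt] at hc
  refine ⟨v₀ + c • w, fun s hs => hc.1 s hs, fun w' => (hv₀ w').trans ?_⟩
  rw [map_add, map_smul]
  exact hc.2

/-- A central element is determined by its values on a basis of T, each lying in an orbit space of
dimension at most r. -/
theorem finrank_le_mul [FiniteDimensional k A] (ρ : TwoStepRep ω V) {T : Submodule k V} {r : ℕ}
    (hr : ∀ v, finrank k (LinearMap.range (ρ.orbit v)) ≤ r)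
    (hT : ∀ a, (∀ t ∈ T, ρ.center a t = 0) → a = 0) :
    finrank k A ≤ r * finrank k T := by
  let e := finBasis k T
  let F : A →ₗ[k] ((i : Fin (finrank k T)) → LinearMap.range (ρ.orbit (e i))) :=
    LinearMap.pi fun i => (ρ.orbit (e i)).rangeRestrict
  have hF : Function.Injective F := by
    rw [← LinearMap.ker_eq_bot, LinearMap.ker_eq_bot']
    intro a ha
    refine hT a fun t ht => ?_
    have h0 : ρ.center a ∘ₗ T.subtype = 0 := e.ext fun i => by
      have := congrArg Subtype.val (congrFun ha i)
      simpa [F] using this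
    exact LinearMap.congr_fun h0 ⟨t, ht⟩
  calc finrank k A ≤ _ := LinearMap.finrank_le_finrank_of_injective hF
    _ = ∑ i, finrank k (LinearMap.range (ρ.orbit (e i))) := finrank_pi_fintype k
    _ ≤ ∑ _i : Fin (finrank k T), r := Finset.sum_le_sum fun i _ => hr _
    _ = r * finrank k T := by simp [mul_comm]

variable [FiniteDimensional k W]

/-- Rank-nullity for W acting on v modulo the central orbit, where the kernel is the stabilizer. -/
theorem finrank_le_finrank_image (ρ : TwoStepRep ω V) (v : V) :
    finrank k W + finrank k (LinearMap.range (ρ.orbit v))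
      ≤ finrank k (ρ.image v) + finrank k (ρ.stabilizer v) := by
  let F : W →ₗ[k] V ⧸ LinearMap.range (ρ.orbit v) :=
    (LinearMap.range (ρ.orbit v)).mkQ ∘ₗ ρ.act.flip v
  have h1 := F.finrank_range_add_finrank_ker
  have hker : LinearMap.ker F = ρ.stabilizer v := by
    rw [LinearMap.ker_comp, Submodule.ker_mkQ]; rfl
  have hle : LinearMap.range (ρ.orbit v) ≤ ρ.image v := le_sup_right
  have hrange : LinearMap.range F ≤ (ρ.image v).map (LinearMap.range (ρ.orbit v)).mkQ := by
    rw [LinearMap.range_comp]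
    exact Submodule.map_mono le_sup_left
  have h2 := Submodule.finrank_mono hrange
  have h3 : finrank k ((ρ.image v).map (LinearMap.range (ρ.orbit v)).mkQ)
      + finrank k (LinearMap.range (ρ.orbit v)) = finrank k (ρ.image v) := by
    have h4 := ((LinearMap.range (ρ.orbit v)).mkQ.domRestrict
      (ρ.image v)).finrank_range_add_finrank_ker
    rw [LinearMap.range_domRestrict, LinearMap.ker_domRestrict, Submodule.ker_mkQ] at h4
    rw [← h4, (Submodule.comapSubtypeEquivOfLe hle).finrank_eq]
  rw [hker] at h1
  omega

variable [FiniteDimensional k A]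

theorem exists_le_finrank [Infinite k] (ρ : TwoStepRep ω V) (hact : ∀ w, IsNilpotent (ρ.act w))
    (hcenter : ∀ a, IsNilpotent (ρ.center a)) (hinj : Function.Injective ρ.center)
    {S : Set A} (hS : S.Finite) (hS0 : ∀ s ∈ S, s ≠ 0)
    (hω : ∀ f : Dual k A, (∀ s ∈ S, f s ≠ 0) → ∀ w, (∀ w', f (ω w w') = 0) → w = 0) :
    ∃ r b, finrank k A ≤ r * b ∧ finrank k W + 2 * (r + b) ≤ 2 * finrank k V := by
  obtain ⟨v, hv, hr⟩ := ρ.exists_generic hinj hS hS0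
  have := hS.to_subtype
  obtain ⟨φ, hφ⟩ := Module.exists_dual_forall_apply_ne_zero (K := k)
    (fun s : S => ρ.center s v) fun s => hv s s.2
  have h1 := ρ.two_mul_finrank_stabilizer_le v φ
    (hω (φ ∘ₗ ρ.orbit v) fun s hs => hφ ⟨s, hs⟩)
  have h2 := ρ.finrank_le_finrank_image v
  obtain ⟨T, hvT, hT⟩ := (ρ.disjoint_span_image hact hcenter v).exists_isCompl
  refine ⟨_, finrank k T, ρ.finrank_le_mul hr (T := T) fun a ha => ?_, ?_⟩
  -- Being central, a kills the whole image of v once it kills v; with T this exhausts V.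
  · have hav : ρ.center a v = 0 := ha v (hvT (Submodule.mem_span_singleton_self v))
    refine hinj ?_
    rw [map_zero, ← LinearMap.ker_eq_top, eq_top_iff, ← hT.sup_eq_top, image]
    refine sup_le ha (sup_le ?_ ?_)
    · rintro _ ⟨w, rfl⟩
      have := LinearMap.congr_fun (ρ.commute_act a w).eq v
      simpa [hav] using this
    · rintro _ ⟨b, rfl⟩
      have := LinearMap.congr_fun (ρ.commute_center a b).eq v
      simpa [hav] using this
  · have := Submodule.finrank_add_eq_of_isCompl hT
    omega

end TwoStepRep

/-! ### Small ideals of k[t]/(p) -/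

/-- Every nonzero ideal of `k[t]/(p)` meets a fixed finite set of nonzero elements. -/
theorem AdjoinRoot.exists_finite_forall_exists_mul_mem {k : Type*} [Field k] {p : k[X]}
    (hp : p ≠ 0) :
    ∃ S : Set (AdjoinRoot p), S.Finite ∧ (∀ s ∈ S, s ≠ 0) ∧ ∀ q, q ≠ 0 → ∃ c, c * q ∈ S := by
  classical
  -- The classes p/f generate the minimal ideals. For q the class of g, put d = gcd(g, p) and p =
  -- de: any irreducible f dividing e makes p/f a multiple of d, and d lies in (q) by Bézout.
  refine ⟨{s | ∃ f ∈ UniqueFactorizationMonoid.normalizedFactors p, AdjoinRoot.mk p (p / f) = s},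
    ?_, ?_, ?_⟩
  · exact ((UniqueFactorizationMonoid.normalizedFactors p).toFinset.finite_toSet.image
      (fun f => AdjoinRoot.mk p (p / f))).subset fun s ⟨f, hf, h⟩ => ⟨f, Multiset.mem_toFinset.2 hf, h⟩
  · rintro _ ⟨f, hf, rfl⟩ h
    rw [AdjoinRoot.mk_eq_zero] at h
    have hirr := UniqueFactorizationMonoid.irreducible_of_normalized_factor f hf
    have hdvd := UniqueFactorizationMonoid.dvd_of_mem_normalizedFactors hf
    have hmul : f * (p / f) = p := EuclideanDomain.mul_div_cancel' hirr.ne_zero hdvd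
    have hne : p / f ≠ 0 := by
      rintro h0
      rw [h0, mul_zero] at hmul
      exact hp hmul.symm
    obtain ⟨g, hg⟩ := h
    refine hirr.not_isUnit (IsUnit.of_mul_eq_one g (mul_right_cancel₀ hne ?_))
    rw [one_mul, mul_right_comm, hmul, ← hg]
  · intro q hq
    obtain ⟨g, rfl⟩ := AdjoinRoot.mk_surjective q
    obtain ⟨e, he⟩ := EuclideanDomain.gcd_dvd_right g p
    have hbez := EuclideanDomain.gcd_eq_gcd_ab g p
    have hdg := EuclideanDomain.gcd_dvd_left g p
    set d := EuclideanDomain.gcd g p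
    have heu : ¬ IsUnit e := fun hu => by
      refine hq (AdjoinRoot.mk_eq_zero.2 ?_)
      rw [he]
      exact (hu.mul_right_dvd).2 hdg
    have he0 : e ≠ 0 := by
      rintro rfl
      exact hp (by rw [he, mul_zero])
    obtain ⟨f', hf', hdvd'⟩ := WfDvdMonoid.exists_irreducible_factor heu he0
    obtain ⟨f, hf, hff⟩ := UniqueFactorizationMonoid.exists_mem_normalizedFactors_of_dvd hp hf'
      (hdvd'.trans ⟨d, by rw [he, mul_comm]⟩)
    obtain ⟨e', he'⟩ := hff.dvd_iff_dvd_left.1 hdvd'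
    have hf0 := (UniqueFactorizationMonoid.irreducible_of_normalized_factor f hf).ne_zero
    have hdiv : p / f = d * e' := by
      conv_lhs => rw [he, he', mul_left_comm]
      exact mul_div_cancel_left₀ _ hf0
    refine ⟨AdjoinRoot.mk p (EuclideanDomain.gcdA g p * e'), f, hf, ?_⟩
    rw [hdiv, hbez, add_mul, map_add, mul_assoc p, map_mul _ p, AdjoinRoot.mk_self, zero_mul,
      add_zero, ← map_mul]
    congr 1
    ring

/-! ### Coordinates on the current algebra -/

namespace HeisenbergAlgebra

variable {k : Type*} [Field k] {m : ℕ} {ι : Type*}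

theorem x_sum (s : Finset ι) (f : ι → HeisenbergAlgebra k m) :
    (∑ i ∈ s, f i).x = ∑ i ∈ s, (f i).x :=
  map_sum (⟨⟨HeisenbergAlgebra.x, rfl⟩, fun _ _ => rfl⟩ : HeisenbergAlgebra k m →+ (Fin m → k)) f s

theorem y_sum (s : Finset ι) (f : ι → HeisenbergAlgebra k m) :
    (∑ i ∈ s, f i).y = ∑ i ∈ s, (f i).y :=
  map_sum (⟨⟨HeisenbergAlgebra.y, rfl⟩, fun _ _ => rfl⟩ : HeisenbergAlgebra k m →+ (Fin m → k)) f s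

theorem z_sum (s : Finset ι) (f : ι → HeisenbergAlgebra k m) :
    (∑ i ∈ s, f i).z = ∑ i ∈ s, (f i).z :=
  map_sum (⟨⟨HeisenbergAlgebra.z, rfl⟩, fun _ _ => rfl⟩ : HeisenbergAlgebra k m →+ (k)) f s

theorem eq_sum (h : HeisenbergAlgebra k m) :
    ∑ i, h.x i • (⟨Pi.single i 1, 0, 0⟩ : HeisenbergAlgebra k m)
      + ∑ i, h.y i • (⟨0, Pi.single i 1, 0⟩ : HeisenbergAlgebra k m)
      + h.z • (⟨0, 0, 1⟩ : HeisenbergAlgebra k m) = h := by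
  refine HeisenbergAlgebra.ext ?_ ?_ ?_
  · ext i
    simp [x_sum, Pi.single_apply]
  · ext i
    simp [y_sum, Pi.single_apply]
  · simp [z_sum]

end HeisenbergAlgebra

namespace CurrentHeisenberg

section Form

variable (k A : Type*) [Field k] [CommRing A] [Algebra k A] (m : ℕ)

/-- The standard alternating form on `A ^ m × A ^ m`, as a `k`-bilinear map. -/
def form : ((Fin m → A) × (Fin m → A)) →ₗ[k] ((Fin m → A) × (Fin m → A)) →ₗ[k] A :=
  LinearMap.mk₂ k (fun w w' => ∑ i, (w.1 i * w'.2 i - w'.1 i * w.2 i))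
    (fun w₁ w₂ w' => by
      rw [← Finset.sum_add_distrib]
      exact Finset.sum_congr rfl fun i _ => by simp; ring)
    (fun c w w' => by
      rw [Finset.smul_sum]
      exact Finset.sum_congr rfl fun i _ => by simp [smul_sub])
    (fun w w₁ w₂ => by
      rw [← Finset.sum_add_distrib]
      exact Finset.sum_congr rfl fun i _ => by simp; ring)
    (fun c w w' => by
      rw [Finset.smul_sum]
      exact Finset.sum_congr rfl fun i _ => by simp [smul_sub])

variable {k A m}

theorem form_apply (w w' : (Fin m → A) × (Fin m → A)) :
    form k A m w w' = ∑ i, (w.1 i * w'.2 i - w'.1 i * w.2 i) := rfl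

@[simp] theorem form_inl (w : (Fin m → A) × (Fin m → A)) (i : Fin m) (c : A) :
    form k A m w (Pi.single i c, 0) = -(c * w.2 i) := by
  rw [form_apply, Finset.sum_eq_single i] <;> simp +contextual

@[simp] theorem form_inr (w : (Fin m → A) × (Fin m → A)) (i : Fin m) (c : A) :
    form k A m w (0, Pi.single i c) = w.1 i * c := by
  rw [form_apply, Finset.sum_eq_single i] <;> simp +contextual

/-- Testing against vectors supported in one slot isolates each coordinate of w in the pairing f(cq)
on A. -/
theorem eq_zero_of_form (f : Module.Dual k A) (hf : ∀ q, (∀ c, f (c * q) = 0) → q = 0)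
    {w : (Fin m → A) × (Fin m → A)} (hw : ∀ w', f (form k A m w w') = 0) : w = 0 := by
  refine Prod.ext (funext fun i => hf _ fun c => ?_) (funext fun i => hf _ fun c => ?_)
  · simpa [mul_comm] using hw (0, Pi.single i c)
  · simpa using hw (Pi.single i c, 0)

theorem exists_form_eq (hm : 1 ≤ m) (a : A) : ∃ w w', form k A m w w' = a :=
  ⟨(Pi.single ⟨0, hm⟩ 1, 0), (0, Pi.single ⟨0, hm⟩ a), by simp⟩

end Form

section Coordinates

variable (k A : Type*) [Field k] [CommRing A] [Algebra k A] (m : ℕ)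

/-- The coordinates of an element of `A ⊗ 𝔥ₘ`. -/
def coordsHom : A ⊗[k] HeisenbergAlgebra k m →ₗ[k] ((Fin m → A) × (Fin m → A)) × A :=
  TensorProduct.lift (LinearMap.mk₂ k
    (fun q h => ((fun i => h.x i • q, fun i => h.y i • q), h.z • q))
    (fun _ _ _ => by ext <;> simp)
    (fun _ _ _ => by ext <;> exact smul_comm _ _ _)
    (fun _ _ _ => by ext <;> simp [add_smul])
    (fun _ _ _ => by ext <;> simp [mul_smul]))

/-- The element of `A ⊗ 𝔥ₘ` with given coordinates. -/
def ofCoords : ((Fin m → A) × (Fin m → A)) × A →ₗ[k] A ⊗[k] HeisenbergAlgebra k m where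
  toFun c := ∑ i, c.1.1 i ⊗ₜ[k] (⟨Pi.single i 1, 0, 0⟩ : HeisenbergAlgebra k m)
    + ∑ i, c.1.2 i ⊗ₜ[k] (⟨0, Pi.single i 1, 0⟩ : HeisenbergAlgebra k m)
    + c.2 ⊗ₜ[k] (⟨0, 0, 1⟩ : HeisenbergAlgebra k m)
  map_add' c c' := by
    simp only [Prod.fst_add, Prod.snd_add, Pi.add_apply, TensorProduct.add_tmul,
      Finset.sum_add_distrib]
    abel
  map_smul' r c := by
    simp only [Prod.smul_fst, Prod.smul_snd, Pi.smul_apply, ← TensorProduct.smul_tmul',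
      ← Finset.smul_sum, ← smul_add, RingHom.id_apply]

/-- Coordinates as a linear equivalence. -/
def coords : A ⊗[k] HeisenbergAlgebra k m ≃ₗ[k] ((Fin m → A) × (Fin m → A)) × A :=
  LinearEquiv.ofLinearMap (coordsHom k A m) (ofCoords k A m)
    (by
      refine LinearMap.ext fun c => ?_
      ext i <;> simp [coordsHom, ofCoords, Prod.fst_sum, Prod.snd_sum, Pi.single_apply])
    (by
      refine TensorProduct.ext' fun q h => ?_
      simp only [coordsHom, ofCoords, LinearMap.comp_apply, TensorProduct.lift.tmul,
        LinearMap.mk₂_apply, LinearMap.coe_mk, AddHom.coe_mk, LinearMap.id_apply]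
      conv_rhs => rw [← h.eq_sum]
      simp [TensorProduct.tmul_add, TensorProduct.tmul_sum, TensorProduct.smul_tmul])

variable {k A m}

@[simp] theorem coords_tmul (q : A) (h : HeisenbergAlgebra k m) :
    coords k A m (q ⊗ₜ h) = ((fun i => h.x i • q, fun i => h.y i • q), h.z • q) := rfl

theorem coords_lie (ξ η : A ⊗[k] HeisenbergAlgebra k m) :
    coords k A m ⁅ξ, η⁆ = (0, form k A m (coords k A m ξ).1 (coords k A m η).1) := by
  induction ξ using TensorProduct.induction_on with
  | zero =>
    have h0 : ⁅(0 : A ⊗[k] HeisenbergAlgebra k m), η⁆ = 0 := zero_lie η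
    rw [h0]; simp; rfl
  | add ξ ξ' h h' =>
    have h0 : ⁅ξ + ξ', η⁆ = ⁅ξ, η⁆ + ⁅ξ', η⁆ := add_lie ξ ξ' η
    simp [h0, h, h']
  | tmul q a =>
    induction η using TensorProduct.induction_on with
    | zero =>
      have h0 : ⁅q ⊗ₜ[k] a, (0 : A ⊗[k] HeisenbergAlgebra k m)⁆ = 0 := lie_zero (q ⊗ₜ[k] a)
      rw [h0]; simp; rfl
    | add η η' h h' =>
      have h0 : ⁅q ⊗ₜ[k] a, η + η'⁆ = ⁅q ⊗ₜ[k] a, η⁆ + ⁅q ⊗ₜ[k] a, η'⁆ := lie_add (q ⊗ₜ[k] a) η η'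
      rw [h0, map_add, h, h']; simp
    | tmul q' a' =>
      rw [LieAlgebra.ExtendScalars.bracket_tmul]
      refine Prod.ext ?_ ?_
      · ext i <;> simp
      · simp only [coords_tmul, HeisenbergAlgebra.z_lie, form_apply, Finset.sum_smul, sub_smul]
        exact Finset.sum_congr rfl fun i _ => by
          simp only [smul_mul_smul_comm, mul_comm q' q]

theorem lie_coords_symm (c c' : ((Fin m → A) × (Fin m → A)) × A) :
    ⁅(coords k A m).symm c, (coords k A m).symm c'⁆
      = (coords k A m).symm (0, form k A m c.1 c'.1) := by
  rw [LinearEquiv.eq_symm_apply, coords_lie, LinearEquiv.apply_symm_apply,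
    LinearEquiv.apply_symm_apply]

end Coordinates

/-! ### Lie modules as two-step representations, and the model -/

section Representations

attribute [local instance] LieRing.ofAssociativeRing

variable {k A V : Type*} [Field k] [CommRing A] [Algebra k A] {m : ℕ} [AddCommGroup V]
  [Module k V]

/-- A Lie module over `A ⊗ 𝔥ₘ` in coordinates. -/
def coordsToEnd (k A V : Type*) [Field k] [CommRing A] [Algebra k A] (m : ℕ) [AddCommGroup V]
    [Module k V] [LieRingModule (A ⊗[k] HeisenbergAlgebra k m) V]
    [LieModule k (A ⊗[k] HeisenbergAlgebra k m) V] :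
    ((Fin m → A) × (Fin m → A)) × A →ₗ[k] Module.End k V where
  toFun c := LieModule.toEnd k (A ⊗[k] HeisenbergAlgebra k m) V ((coords k A m).symm c)
  map_add' c c' := by
    rw [map_add]
    exact map_add (LieModule.toEnd k (A ⊗[k] HeisenbergAlgebra k m) V) _ _
  map_smul' r c := by
    rw [map_smul]
    exact map_smul (LieModule.toEnd k (A ⊗[k] HeisenbergAlgebra k m) V) _ _

theorem coordsToEnd_commutator (k A V : Type*) [Field k] [CommRing A] [Algebra k A] (m : ℕ)
    [AddCommGroup V] [Module k V] [LieRingModule (A ⊗[k] HeisenbergAlgebra k m) V]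
    [LieModule k (A ⊗[k] HeisenbergAlgebra k m) V] (c c' : ((Fin m → A) × (Fin m → A)) × A) :
    coordsToEnd k A V m c * coordsToEnd k A V m c' - coordsToEnd k A V m c' * coordsToEnd k A V m c
      = coordsToEnd k A V m (0, form k A m c.1 c'.1) := by
  have h := LieHom.map_lie (LieModule.toEnd k (A ⊗[k] HeisenbergAlgebra k m) V)
    ((coords k A m).symm c) ((coords k A m).symm c')
  exact h.symm.trans (congrArg _ (lie_coords_symm c c'))

/-- A Lie module over `A ⊗ 𝔥ₘ` as a representation of a two-step nilpotent Lie algebra. -/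
def toTwoStepRep (k A V : Type*) [Field k] [CommRing A] [Algebra k A] (m : ℕ) [AddCommGroup V]
    [Module k V] [LieRingModule (A ⊗[k] HeisenbergAlgebra k m) V]
    [LieModule k (A ⊗[k] HeisenbergAlgebra k m) V] : TwoStepRep (form k A m) V where
  act := coordsToEnd k A V m ∘ₗ LinearMap.inl k _ _
  center := coordsToEnd k A V m ∘ₗ LinearMap.inr k _ _
  commute_center a a' := sub_eq_zero.1 ((coordsToEnd_commutator k A V m _ _).trans (by simp; exact map_zero _))
  commute_act a w := sub_eq_zero.1 ((coordsToEnd_commutator k A V m _ _).trans (by simp; exact map_zero _))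
  commutator_act w w' := coordsToEnd_commutator k A V m _ _

/-- The Lie algebra homomorphism of a representation given in coordinates. -/
def lieHom (ρ : TwoStepRep (form k A m) V) :
    A ⊗[k] HeisenbergAlgebra k m →ₗ⁅k⁆ Module.End k V where
  toLinearMap := (ρ.act.coprod ρ.center) ∘ₗ (coords k A m : _ →ₗ[k] _)
  map_lie' {ξ η} := by
    have h1 := (ρ.commute_act (coords k A m ξ).2 (coords k A m η).1).eq
    have h2 := (ρ.commute_act (coords k A m η).2 (coords k A m ξ).1).eq
    have h3 := (ρ.commute_center (coords k A m ξ).2 (coords k A m η).2).eq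
    have h4 := ρ.commutator_act (coords k A m ξ).1 (coords k A m η).1
    simp only [LinearMap.coe_comp, LinearEquiv.coe_coe, Function.comp_apply,
      LinearMap.coprod_apply, coords_lie, AddHom.toFun_eq_coe, LinearMap.coe_toAddHom, map_zero,
      zero_add, Ring.lie_def, add_mul, mul_add, h1, h2, h3, ← h4]
    abel

theorem lieHom_apply (ρ : TwoStepRep (form k A m) V) (ξ : A ⊗[k] HeisenbergAlgebra k m) :
    lieHom ρ ξ = ρ.act (coords k A m ξ).1 + ρ.center (coords k A m ξ).2 := rfl

/-- If w + a acts as zero, w acts as a central operator, so all the ω(w,w') act as zero; injectivity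
on the centre and nondegeneracy of ω give w = 0. -/
theorem lieHom_injective (ρ : TwoStepRep (form k A m) V)
    (hinj : Function.Injective ρ.center) : Function.Injective (lieHom ρ) := by
  have hc : ∀ a, ρ.center a = 0 → a = 0 := fun a h => hinj (by rw [h, map_zero])
  refine (injective_iff_map_eq_zero _).2 fun ξ hξ => ?_
  rw [lieHom_apply] at hξ
  have hw : (coords k A m ξ).1 = 0 := by
    have h0 : ∀ w', form k A m (coords k A m ξ).1 w' = 0 := fun w' => hc _ (by
      rw [← ρ.commutator_act, eq_neg_of_add_eq_zero_left hξ, neg_mul, mul_neg,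
        (ρ.commute_act _ _).eq, sub_self])
    refine Prod.ext (funext fun i => ?_) (funext fun i => ?_)
    · simpa using h0 (0, Pi.single i 1)
    · simpa using h0 (Pi.single i 1, 0)
  rw [hw, map_zero, zero_add] at hξ
  exact (coords k A m).map_eq_zero_iff.1 (Prod.ext hw (hc _ hξ))

/-- The representation on `k ^ a × A ^ m × k ^ b` defined by a functional `f` and two families of
elements of `A`. -/
def model (f : Module.Dual k A) {a b : ℕ} (α : Fin a → A) (β : Fin b → A) (m : ℕ) :
    TwoStepRep (form k A m) ((Fin a → k) × (Fin m → A) × (Fin b → k)) where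
  -- With w = (x, y), y maps k^b to A^m and x maps A^m to k^a. Only products of an x with a y
  -- survive, and z acts by the a × b matrix f(α_i z β_l).
  act := LinearMap.mk₂ k
    (fun w v => (fun i => f (α i * ∑ j, w.1 j * v.2.1 j),
      fun j => w.2 j * ∑ l, v.2.2 l • β l, 0))
    (fun _ _ _ => by ext <;> simp [add_mul, mul_add, Finset.sum_add_distrib])
    (fun _ _ _ => by ext <;> simp [← Finset.smul_sum])
    (fun _ _ _ => by ext <;> simp [add_smul, mul_add, Finset.sum_add_distrib])
    (fun _ _ _ => by ext <;> simp [mul_smul, ← Finset.smul_sum])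
  center := LinearMap.mk₂ k
    (fun z v => (fun i => f (α i * (z * ∑ l, v.2.2 l • β l)), 0, 0))
    (fun _ _ _ => by ext <;> simp [add_mul, mul_add])
    (fun _ _ _ => by ext <;> simp)
    (fun _ _ _ => by ext <;> simp [add_smul, mul_add, Finset.sum_add_distrib])
    (fun _ _ _ => by ext <;> simp [mul_smul, ← Finset.smul_sum])
  commute_center _ _ := LinearMap.ext fun _ => by ext <;> simp
  commute_act _ _ := LinearMap.ext fun _ => by ext <;> simp
  commutator_act w w' := LinearMap.ext fun v => by
    ext i
    · simp only [LinearMap.sub_apply, Module.End.mul_apply, LinearMap.mk₂_apply, Prod.fst_sub,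
        Pi.sub_apply, form_apply, ← map_sub, ← mul_sub, Finset.sum_mul, ← Finset.sum_sub_distrib]
      congr 2
      exact Finset.sum_congr rfl fun j _ => by ring
    · simp
    · simp

theorem model_center_injective (f : Module.Dual k A) {a b : ℕ} (α : Fin a → A) (β : Fin b → A)
    (h : ∀ z, (∀ i l, f (α i * (z * β l)) = 0) → z = 0) :
    Function.Injective (model f α β m).center := by
  refine (injective_iff_map_eq_zero _).2 fun z hz => h z fun i l => ?_
  have := congrFun (congrArg Prod.fst (LinearMap.congr_fun hz (0, 0, Pi.single l 1))) i
  simpa [model, Pi.single_apply, ite_smul] using this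

end Representations

end CurrentHeisenberg

/-! ### Arithmetic of ⌈2√d⌉ -/

theorem Nat.ceil_two_mul_sqrt_le {d r b : ℕ} (h : d ≤ r * b) :
    ⌈2 * Real.sqrt (d : ℝ)⌉₊ ≤ r + b := by
  rw [Nat.ceil_le]
  have h' : (d : ℝ) ≤ r * b := by exact_mod_cast h
  have h2 : Real.sqrt (d : ℝ) ≤ (r + b) / 2 := by
    rw [Real.sqrt_le_left (by positivity)]
    nlinarith [sq_nonneg ((r : ℝ) - b)]
  push_cast
  linarith

theorem Nat.exists_add_eq_ceil_two_mul_sqrt (d : ℕ) :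
    ∃ a b : ℕ, d ≤ a * b ∧ a + b = ⌈2 * Real.sqrt (d : ℝ)⌉₊ := by
  set c := ⌈2 * Real.sqrt (d : ℝ)⌉₊ with hc
  have h1 : 2 * Real.sqrt (d : ℝ) ≤ c := Nat.le_ceil _
  have h2 : 4 * d ≤ c * c := by
    have h4 := Real.sqrt_nonneg (d : ℝ)
    have h3 := Real.mul_self_sqrt (Nat.cast_nonneg (α := ℝ) d)
    have : (4 * d : ℝ) ≤ c * c := by nlinarith
    exact_mod_cast this
  -- The two halves of c have product ⌊c²/4⌋, which is at least d since 4d ≤ c².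
  refine ⟨c / 2, c - c / 2, ?_, by omega⟩
  rcases Nat.even_or_odd' c with ⟨e, he | he⟩
  · rw [show c / 2 = e by omega, show c - e = e by omega]
    rw [he] at h2
    nlinarith
  · rw [show c / 2 = e by omega, show c - e = e + 1 by omega]
    rw [he] at h2
    nlinarith

theorem AdjoinRoot.exists_dual_nondegenerate {k : Type*} [Field k] [Infinite k] {p : k[X]}
    (hp : p ≠ 0) :
    ∃ f : Module.Dual k (AdjoinRoot p), ∀ q, (∀ c, f (c * q) = 0) → q = 0 := by
  obtain ⟨S, hS, hS0, hSq⟩ := AdjoinRoot.exists_finite_forall_exists_mul_mem hp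
  have := hS.to_subtype
  obtain ⟨f, hf⟩ := Module.exists_dual_forall_apply_ne_zero (K := k) (fun s : S => s.1)
    fun s => hS0 s s.2
  refine ⟨f, fun q hq => by_contra fun h0 => ?_⟩
  obtain ⟨c, hc⟩ := hSq q h0
  exact hf ⟨_, hc⟩ (hq c)

/-! ### The two inequalities -/

open Module CurrentHeisenberg

section

attribute [local instance] LieRing.ofAssociativeRing

theorem CurrentHeisenberg.mem_faithfulRepDims {k : Type u} [Field k] [Infinite k] (m : ℕ)
    {p : k[X]} (hp : p ≠ 0) {a b : ℕ} (hab : p.natDegree ≤ a * b) :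
    m * p.natDegree + (a + b) ∈ faithfulRepDims k (CurrentHeisenberg k m p) := by
  obtain ⟨f, hf⟩ := AdjoinRoot.exists_dual_nondegenerate hp
  have hfin : FiniteDimensional k (AdjoinRoot p) := (AdjoinRoot.powerBasis hp).finite
  -- By division with remainder by b, the products t^(bi) t^l run over all t^n with n < ab, hence
  -- over the power basis as d ≤ ab.
  let ρ := model f (fun i : Fin a => AdjoinRoot.root p ^ (b * (i : ℕ)))
    (fun l : Fin b => AdjoinRoot.root p ^ (l : ℕ)) m
  have hρ : Function.Injective ρ.center := model_center_injective _ _ _ fun z hz => by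
    refine hf z fun c => ?_
    have h0 : f ∘ₗ LinearMap.mulRight k z = 0 := (AdjoinRoot.powerBasis hp).basis.ext fun n => by
      have hn : (n : ℕ) < a * b := n.2.trans_le (by simpa using hab)
      have hb : 0 < b := Nat.pos_of_ne_zero fun h => by simp [h] at hn
      have := hz ⟨n / b, Nat.div_lt_of_lt_mul (by rwa [mul_comm])⟩ ⟨n % b, Nat.mod_lt _ hb⟩
      rw [mul_left_comm, ← pow_add, Nat.div_add_mod] at this
      simpa [mul_comm z] using this
    exact LinearMap.congr_fun h0 c
  let inst : LieRingModule (CurrentHeisenberg k m p)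
      ((Fin a → k) × (Fin m → AdjoinRoot p) × (Fin b → k)) := LieRingModule.compLieHom _ (lieHom ρ)
  have hmod : LieModule k (CurrentHeisenberg k m p)
      ((Fin a → k) × (Fin m → AdjoinRoot p) × (Fin b → k)) := LieModule.compLieHom _ (lieHom ρ)
  refine ⟨(Fin a → k) × (Fin m → AdjoinRoot p) × (Fin b → k), inferInstance, inferInstance,
    inferInstance, inst, hmod, ⟨?_⟩, ?_⟩
  · exact lieHom_injective ρ hρ
  · have := (AdjoinRoot.powerBasis hp).finrank
    rw [AdjoinRoot.powerBasis_dim] at this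
    simp [finrank_pi_fintype, this]
    ring

end

theorem CurrentHeisenberg.le_of_mem_faithfulRepDims {k : Type u} [Field k] [CharZero k] {m : ℕ}
    (hm : 1 ≤ m) {p : k[X]} (hp : p ≠ 0) {n : ℕ}
    (hn : n ∈ faithfulRepDims k (CurrentHeisenberg k m p)) :
    m * p.natDegree + ⌈2 * Real.sqrt (p.natDegree : ℝ)⌉₊ ≤ n := by
  obtain ⟨V, _, _, _, _, _, hfaith, rfl⟩ := hn
  have hfin : FiniteDimensional k (AdjoinRoot p) := (AdjoinRoot.powerBasis hp).finite
  have hdim := (AdjoinRoot.powerBasis hp).finrank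
  rw [AdjoinRoot.powerBasis_dim] at hdim
  let ρ := toTwoStepRep k (AdjoinRoot p) V m
  have hρ : Function.Injective ρ.center := fun a a' h =>
    congrArg Prod.snd ((coords k (AdjoinRoot p) m).symm.injective (hfaith.injective_toEnd h))
  obtain ⟨σ, hσρ, hact, hcenter⟩ := ρ.exists_isNilpotent (exists_form_eq hm)
  obtain ⟨S, hS, hS0, hSq⟩ := AdjoinRoot.exists_finite_forall_exists_mul_mem hp
  obtain ⟨r, b, hrb, h⟩ := σ.exists_le_finrank hact hcenter (hσρ ▸ hρ) hS hS0
    fun f hf w hw => eq_zero_of_form f (fun q hq => by_contra fun h0 => by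
      obtain ⟨c, hc⟩ := hSq q h0
      exact hf _ hc (hq c)) hw
  rw [hdim] at hrb
  have h1 := Nat.ceil_two_mul_sqrt_le hrb
  have h2 : finrank k ((Fin m → AdjoinRoot p) × (Fin m → AdjoinRoot p))
      = 2 * (m * p.natDegree) := by
    simp [finrank_pi_fintype, hdim]
    ring
  omega

theorem mainTheorem1 {k : Type u} [Field k] [CharZero k] (m : ℕ) (hm : 1 ≤ m)
    (p : k[X]) (hp : p ≠ 0) :
    IsLeast (faithfulRepDims k (CurrentHeisenberg k m p))
      (m * p.natDegree + ⌈2 * Real.sqrt (p.natDegree : ℝ)⌉₊) := by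
  obtain ⟨a, b, hab, hc⟩ := Nat.exists_add_eq_ceil_two_mul_sqrt p.natDegree
  exact ⟨hc ▸ mem_faithfulRepDims m hp hab, fun _ => le_of_mem_faithfulRepDims hm hp⟩
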